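/- A \emph{skew (left) brace} is a set $B$ with two operations $+$ and $\cdot$ such that $(B,+)$ and $(B,\cdot)$ are (not necessarily abelian) groups and $x\cdot(y+z)=x\cdot y-x+x\cdot z$ for all $x,y,z\in B$. The two groups then have the same identity element $0$, and for $a\in B$ the map $\lambda_a\colon b\mapsto -a+a\cdot b$ is an automorphism of $(B,+)$. An \emph{ideal} of $B$ is a subset that is a normal subgroup of both $(B,+)$ and $(B,\cdot)$ and is mapped into itself by $\lambda_b$ for every $b\in B$; the quotient $B/I$ by an ideal $I$ is again a skew brace. The \emph{socle} of $B$ is $\operatorname{Soc}(B)=\{a\in B:\lambda_a=\mathrm{id}\}\cap Z(B,+)$. The skew brace $B$ is \emph{supersoluble} if there is a finite chain of ideals $\{0\}=I_0\le I_1\le\dots\le I_n=B$ of $B$ such that, for all $0\le i<n$, either $(I_{i+1}/I_i,+)$ is infinite cyclic and $I_{i+1}/I_i\le\operatorname{Soc}(B/I_i)$, or $I_{i+1}/I_i$ has prime order. \textbf{Theorem.} Let $B$ be a supersoluble skew brace. Then $B$ has a finite chain of ideals $$\{0\}=I_{0,0}\leq I_{0,1}\leq\ldots\leq I_{0,\ell}=I_{1,0}\leq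 I_{1,1}\leq\ldots\leq I_{1,m}=I_{2,0}\leq I_{2,1}\leq\ldots\leq I_{2,n}=B$$ (where $\ell,m,n\ge 0$) satisfying the following properties: \begin{itemize} \item $|I_{0,i+1}/I_{0,i}|$ is an odd prime number for all $0\leq i<\ell$; \item $|I_{0,i+1}/I_{0,i}|\geq |I_{0,i+2}/I_{0,i+1}|$ for all $0\leq i<\ell-1$; \item $I_{1,i+1}/I_{1,i}\leq\operatorname{Soc}(B/I_{1,i})$ and $(I_{1,i+1}/I_{1,i},+)$ is infinite cyclic for all $0\leq i<m$; \item $|I_{2,i+1}/I_{2,i}|=2$ for all $0\leq i<n$. \end{itemize} -/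

import Mathlib

/-- A skew left brace: a set with two group structures, `+` (not necessarily commutative) and `*`,
such that `a * (b + c) = a * b - a + a * c`. -/
class SkewBrace (B : Type*) extends AddGroup B, Group B where
  /-- The skew distributive law. -/
  skew_distrib : ∀ a b c : B, a * (b + c) = a * b - a + a * c

namespace SkewBrace

section Basic

variable {B : Type*} [SkewBrace B]

theorem one_eq_zero : (1 : B) = 0 := by
  have h := skew_distrib (1 : B) 0 0
  simp only [one_mul, add_zero, zero_sub] at h
  exact neg_eq_zero.mp h.symm

theorem mul_zero_eq (a : B) : a * 0 = a := by
  rw [← one_eq_zero, mul_one]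

theorem zero_mul_eq (a : B) : 0 * a = a := by
  rw [← one_eq_zero, one_mul]

theorem lam_add (a b c : B) : -a + a * (b + c) = (-a + a * b) + (-a + a * c) := by
  rw [skew_distrib]
  simp only [sub_eq_add_neg, add_assoc]

theorem lam_mul (a b c : B) : -(a * b) + a * b * c = -a + a * (-b + b * c) := by
  have h := lam_add a b (-b + b * c)
  rw [add_neg_cancel_left, add_assoc] at h
  have h2 := add_left_cancel h
  have h3 := congrArg (fun x => -(a * b) + x) h2
  simp only [neg_add_cancel_left] at h3
  rw [mul_assoc]
  exact h3

/-- The additive automorphism `λ_a` of `(B, +)`, `λ_a (b) = -a + a * b`. -/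
def lam (a : B) : B ≃+ B where
  toFun b := -a + a * b
  invFun b := -a⁻¹ + a⁻¹ * b
  left_inv b := by
    have h := lam_mul a⁻¹ a b
    rw [inv_mul_cancel, one_mul, one_eq_zero, neg_zero, zero_add] at h
    exact h.symm
  right_inv b := by
    have h := lam_mul a a⁻¹ b
    rw [mul_inv_cancel, one_mul, one_eq_zero, neg_zero, zero_add] at h
    exact h.symm
  map_add' := lam_add a

theorem lam_apply (a b : B) : lam a b = -a + a * b := rfl

variable (B) in
/-- The socle `Soc(B) = Ker λ ∩ Z(B, +)`. -/
def socle : Set B := {a : B | lam a = AddEquiv.refl B ∧ a ∈ AddSubgroup.center B}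

variable (B) in
/-- An ideal of a skew brace: a subset that is a subgroup of both groups, invariant under every
`λ_b`, and normal in both groups. -/
@[ext] structure Ideal where
  carrier : Set B
  zero_mem : (0 : B) ∈ carrier
  add_mem : ∀ {a b : B}, a ∈ carrier → b ∈ carrier → a + b ∈ carrier
  neg_mem : ∀ {a : B}, a ∈ carrier → -a ∈ carrier
  mul_mem : ∀ {a b : B}, a ∈ carrier → b ∈ carrier → a * b ∈ carrier
  inv_mem : ∀ {a : B}, a ∈ carrier → a⁻¹ ∈ carrier
  lam_mem : ∀ (b : B) {a : B}, a ∈ carrier → lam b a ∈ carrier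
  add_conj_mem : ∀ (b : B) {a : B}, a ∈ carrier → b + a + -b ∈ carrier
  mul_conj_mem : ∀ (b : B) {a : B}, a ∈ carrier → b * a * b⁻¹ ∈ carrier

namespace Ideal

instance : LE (Ideal B) := ⟨fun I J => I.carrier ⊆ J.carrier⟩

/-- The zero ideal `{0}`. -/
instance : Bot (Ideal B) := ⟨{
  carrier := {0}
  zero_mem := rfl
  add_mem := by rintro a b rfl rfl; exact add_zero 0
  neg_mem := by rintro a rfl; exact neg_zero
  mul_mem := by rintro a b rfl rfl; exact mul_zero_eq 0
  inv_mem := by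
    rintro a rfl
    change (0 : B)⁻¹ = 0
    rw [← one_eq_zero, inv_one]
  lam_mem := by rintro b a rfl; exact map_zero (lam b)
  add_conj_mem := by
    rintro b a rfl
    change b + 0 + -b = 0
    rw [add_zero, add_neg_cancel]
  mul_conj_mem := by
    rintro b a rfl
    change b * 0 * b⁻¹ = 0
    rw [mul_zero_eq, mul_inv_cancel, one_eq_zero] }⟩

/-- The whole brace as an ideal. -/
instance : Top (Ideal B) := ⟨{
  carrier := Set.univ
  zero_mem := trivial
  add_mem := fun _ _ => trivial
  neg_mem := fun _ => trivial
  mul_mem := fun _ _ => trivial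
  inv_mem := fun _ => trivial
  lam_mem := fun _ _ _ => trivial
  add_conj_mem := fun _ _ _ => trivial
  mul_conj_mem := fun _ _ _ => trivial }⟩

/-- The additive subgroup underlying an ideal. -/
def toAddSubgroup (I : Ideal B) : AddSubgroup B where
  carrier := I.carrier
  zero_mem' := I.zero_mem
  add_mem' := I.add_mem
  neg_mem' := I.neg_mem

instance (I : Ideal B) : I.toAddSubgroup.Normal := ⟨fun _ ha b => I.add_conj_mem b ha⟩

/-- Modulo an ideal, `*` is compatible with congruence modulo the additive subgroup. -/
theorem mul_congr (I : Ideal B) {a a' b b' : B} (ha : -a + a' ∈ I.carrier)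
    (hb : -b + b' ∈ I.carrier) : -(a * b) + a' * b' ∈ I.carrier := by
  -- cosets of `+` and `*` agree: `a⁻¹ * a' = λ_{a⁻¹} (-a + a')`
  have key : ∀ x y : B, x⁻¹ * y = lam x⁻¹ (-x + y) := by
    intro x y
    have h := lam_mul x⁻¹ x (x⁻¹ * y)
    rw [inv_mul_cancel, one_mul, one_eq_zero, neg_zero, zero_add, mul_inv_cancel_left] at h
    exact h
  have key' : ∀ x y : B, -x + y = lam x (x⁻¹ * y) := by
    intro x y
    rw [lam_apply, mul_inv_cancel_left]
  have hu : a⁻¹ * a' ∈ I.carrier := by rw [key]; exact I.lam_mem _ ha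
  have hv : b⁻¹ * b' ∈ I.carrier := by rw [key]; exact I.lam_mem _ hb
  rw [key']
  refine I.lam_mem _ ?_
  have h1 := I.mul_mem (I.mul_conj_mem b⁻¹ hu) hv
  have h2 : (a * b)⁻¹ * (a' * b') = b⁻¹ * (a⁻¹ * a') * b⁻¹⁻¹ * (b⁻¹ * b') := by group
  rw [h2]
  exact h1

/-- Modulo an ideal, `⁻¹` is compatible with congruence modulo the additive subgroup. -/
theorem inv_congr (I : Ideal B) {a a' : B} (ha : -a + a' ∈ I.carrier) :
    -a⁻¹ + a'⁻¹ ∈ I.carrier := by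
  have h1 := I.mul_congr (a := a⁻¹) (a' := a⁻¹) (by rw [neg_add_cancel]; exact I.zero_mem) ha
  have h2 := I.mul_congr h1 (b := a'⁻¹) (b' := a'⁻¹) (by rw [neg_add_cancel]; exact I.zero_mem)
  rw [inv_mul_cancel, one_mul, mul_assoc, mul_inv_cancel, mul_one] at h2
  have h3 := I.neg_mem h2
  rwa [neg_add_rev, neg_neg] at h3

/-- The quotient brace `B / I`: cosets `b + I`, with both operations defined on
representatives. -/
instance (I : Ideal B) : SkewBrace (B ⧸ I.toAddSubgroup) where
  toAddGroup := inferInstance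
  mul := Quotient.map₂ (· * ·) fun _ _ ha _ _ hb =>
    QuotientAddGroup.leftRel_apply.mpr
      (I.mul_congr (QuotientAddGroup.leftRel_apply.mp ha) (QuotientAddGroup.leftRel_apply.mp hb))
  one := QuotientAddGroup.mk 1
  inv := Quotient.map (·⁻¹) fun _ _ ha =>
    QuotientAddGroup.leftRel_apply.mpr (I.inv_congr (QuotientAddGroup.leftRel_apply.mp ha))
  mul_assoc := by
    rintro ⟨a⟩ ⟨b⟩ ⟨c⟩
    exact congrArg QuotientAddGroup.mk (mul_assoc a b c)
  one_mul := by
    rintro ⟨a⟩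
    exact congrArg QuotientAddGroup.mk (one_mul a)
  mul_one := by
    rintro ⟨a⟩
    exact congrArg QuotientAddGroup.mk (mul_one a)
  inv_mul_cancel := by
    rintro ⟨a⟩
    exact congrArg QuotientAddGroup.mk (inv_mul_cancel a)
  skew_distrib := by
    rintro ⟨a⟩ ⟨b⟩ ⟨c⟩
    exact congrArg QuotientAddGroup.mk (skew_distrib a b c)

/-- For ideals `I ≤ J`, the factor `J / I`, as an additive subgroup of `B / I`. -/
def factor (I J : Ideal B) : AddSubgroup (B ⧸ I.toAddSubgroup) :=
  J.toAddSubgroup.map (QuotientAddGroup.mk' I.toAddSubgroup)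

/-- `(J / I, +)` is infinite cyclic and `J / I ≤ Soc(B / I)`. -/
def IsInfiniteCyclicSocleFactor (I J : Ideal B) : Prop :=
  IsAddCyclic (factor I J) ∧ Infinite (factor I J) ∧
    (factor I J : Set (B ⧸ I.toAddSubgroup)) ⊆ socle (B ⧸ I.toAddSubgroup)

end Ideal

variable (B) in
/-- A skew brace is supersoluble if it has a finite chain of ideals
`{0} = I 0 ≤ I 1 ≤ … ≤ I n = B` in which every factor either has an infinite cyclic additive group
and lies in the socle of the corresponding quotient, or has prime order. (The chain is indexed by
`ℕ`; the values beyond `n` play no role.) -/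
def IsSupersoluble : Prop :=
  ∃ (n : ℕ) (I : ℕ → Ideal B), I 0 = ⊥ ∧ I n = ⊤ ∧
    ∀ i < n, I i ≤ I (i + 1) ∧
      (Ideal.IsInfiniteCyclicSocleFactor (I i) (I (i + 1)) ∨
        (Nat.card (Ideal.factor (I i) (I (i + 1)))).Prime)

end Basic

end SkewBrace

namespace SkewBrace

variable {B : Type*} [SkewBrace B]

theorem mul_eq_add_lam (a b : B) : a * b = a + lam a b := by
  rw [lam_apply, add_neg_cancel_left]

theorem lam_mul_apply (a b c : B) : lam (a * b) c = lam a (lam b c) := lam_mul a b c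

theorem lam_apply_lam_inv (a b : B) : lam a (lam a⁻¹ b) = b := (lam a).apply_symm_apply b

theorem inv_eq_neg_lam (a : B) : a⁻¹ = -lam a⁻¹ a := by
  have h := mul_eq_add_lam a⁻¹ a
  rw [inv_mul_cancel, one_eq_zero] at h
  exact eq_neg_of_add_eq_zero_left h.symm

theorem mem_socle_iff {a : B} :
    a ∈ socle B ↔ ∀ b : B, a + b = b + a ∧ a * b = a + b := by
  constructor
  · rintro ⟨h1, h2⟩ b
    refine ⟨(AddSubgroup.mem_center_iff.mp h2 b).symm, ?_⟩
    rw [mul_eq_add_lam, h1]; rfl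
  · intro h
    refine ⟨?_, AddSubgroup.mem_center_iff.mpr fun b => (h b).1.symm⟩
    ext b
    rw [lam_apply, (h b).2, neg_add_cancel_left]; rfl

theorem lam_of_mem_socle {a : B} (ha : a ∈ socle B) (b : B) : lam a b = b := by
  rw [ha.1]; rfl

/-- The socle as an additive subgroup. -/
def socleAddSubgroup (B : Type*) [SkewBrace B] : AddSubgroup B where
  carrier := socle B
  zero_mem' := mem_socle_iff.mpr fun b => ⟨by simp, by rw [zero_mul_eq, zero_add]⟩
  add_mem' := by
    intro x y hx hy
    rw [mem_socle_iff] at hx hy ⊢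
    intro b
    refine ⟨by rw [add_assoc, (hy b).1, ← add_assoc, (hx b).1, add_assoc], ?_⟩
    rw [← (hx y).2, mul_assoc, (hy b).2, (hx _).2, (hx y).2, add_assoc]
  neg_mem' := by
    intro x hx
    have hx' := mem_socle_iff.mp hx
    have hinv : -x = x⁻¹ := by
      rw [neg_eq_iff_add_eq_zero, ← (hx' _).2, mul_inv_cancel, one_eq_zero]
    rw [mem_socle_iff]
    refine fun b => ⟨?_, ?_⟩
    · rw [neg_add_eq_iff_eq_add, ← add_assoc, (hx' b).1, add_neg_cancel_right]
    · rw [hinv, inv_mul_eq_iff_eq_mul, (hx' _).2, ← hinv, add_neg_cancel_left]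

theorem conj_of_mem_socle {a : B} (ha : a ∈ socle B) (b : B) : b * a * b⁻¹ = lam b a := by
  have hl : lam b a + b = b + lam b a := by
    have h := congrArg (lam b) ((mem_socle_iff.mp ha) (lam b⁻¹ b)).1
    rwa [map_add, map_add, lam_apply_lam_inv] at h
  have h1 : lam (b * a * b⁻¹) b = b := by
    rw [lam_mul_apply, lam_mul_apply, lam_of_mem_socle ha, lam_apply_lam_inv]
  have h2 : b * a = b * a * b⁻¹ + b := by
    have h := mul_eq_add_lam (b * a * b⁻¹) b
    rwa [h1, inv_mul_cancel_right] at h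
  have h3 : b * a = lam b a + b := by rw [mul_eq_add_lam, hl]
  exact add_right_cancel (h2.symm.trans h3)

namespace Ideal

theorem mem_bot {a : B} : a ∈ (⊥ : Ideal B).carrier ↔ a = 0 := Iff.rfl

theorem zsmul_mem (I : Ideal B) {a : B} (ha : a ∈ I.carrier) (k : ℤ) : k • a ∈ I.carrier :=
  I.toAddSubgroup.zsmul_mem ha k

/-- The multiplicative subgroup underlying an ideal. -/
def toSubgroup (I : Ideal B) : Subgroup B where
  carrier := I.carrier
  one_mem' := by rw [one_eq_zero]; exact I.zero_mem
  mul_mem' := I.mul_mem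
  inv_mem' := I.inv_mem

instance (I : Ideal B) : I.toSubgroup.Normal := ⟨fun _ ha b => I.mul_conj_mem b ha⟩

theorem inv_mul_mem_iff (I : Ideal B) {a b : B} : a⁻¹ * b ∈ I.carrier ↔ -a + b ∈ I.carrier := by
  have h : a⁻¹ * b = lam a⁻¹ (-a + b) := by
    have h := lam_mul_apply a⁻¹ a (a⁻¹ * b)
    have h0 : lam a (a⁻¹ * b) = -a + b := by rw [lam_apply, mul_inv_cancel_left]
    rw [h0, inv_mul_cancel, lam_apply, one_mul, one_eq_zero, neg_zero, zero_add] at h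
    exact h
  rw [h]
  refine ⟨fun h => ?_, I.lam_mem _⟩
  have := I.lam_mem a h
  rwa [lam_apply_lam_inv] at this

theorem relIndex_toSubgroup (I J : Ideal B) :
    I.toSubgroup.relIndex J.toSubgroup = I.toAddSubgroup.relIndex J.toAddSubgroup := by
  refine Nat.card_congr (Quotient.congr (Equiv.refl _) fun a b => ?_)
  rw [QuotientGroup.leftRel_apply, QuotientAddGroup.leftRel_apply]
  exact I.inv_mul_mem_iff

theorem card_factor (I J : Ideal B) :
    Nat.card (factor I J) = I.toAddSubgroup.relIndex J.toAddSubgroup := by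
  rw [factor, ← AddSubgroup.relIndex_ker, QuotientAddGroup.ker_mk']

/-- A normal, `λ`-invariant additive subgroup which is closed under multiplicative conjugation is
an ideal. -/
def ofAddSubgroup (P : AddSubgroup B) (hlam : ∀ b : B, ∀ a ∈ P, lam b a ∈ P)
    (hadd : ∀ b : B, ∀ a ∈ P, b + a + -b ∈ P) (hmul : ∀ b : B, ∀ a ∈ P, b * a * b⁻¹ ∈ P) :
    Ideal B where
  carrier := P
  zero_mem := P.zero_mem
  add_mem := P.add_mem
  neg_mem := P.neg_mem
  mul_mem {a b} ha hb := by rw [mul_eq_add_lam]; exact P.add_mem ha (hlam a b hb)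
  inv_mem {a} ha := by rw [inv_eq_neg_lam]; exact P.neg_mem (hlam _ a ha)
  lam_mem b a ha := hlam b a ha
  add_conj_mem b a ha := hadd b a ha
  mul_conj_mem b a ha := hmul b a ha

/-- A `λ`-invariant additive subgroup of the socle is an ideal. -/
def ofLeSocle (P : AddSubgroup B) (hP : P ≤ socleAddSubgroup B)
    (hlam : ∀ b : B, ∀ a ∈ P, lam b a ∈ P) : Ideal B :=
  ofAddSubgroup P hlam
    (fun b a ha => by
      rw [← ((mem_socle_iff.mp (hP ha)) b).1, add_neg_cancel_right]; exact ha)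
    (fun b a ha => by rw [conj_of_mem_socle (hP ha)]; exact hlam b a ha)

/-- `J / I` has prime order `p`. -/
def PrimeStep (p : ℕ) (I J : Ideal B) : Prop :=
  I ≤ J ∧ p.Prime ∧ I.toAddSubgroup.relIndex J.toAddSubgroup = p

/-- Elementwise form of `IsInfiniteCyclicSocleFactor`. -/
def SocleStep (I J : Ideal B) : Prop :=
  I ≤ J ∧ (∃ g ∈ J.carrier, (∀ x ∈ J.carrier, ∃ k : ℤ, -(k • g) + x ∈ I.carrier) ∧
    ∀ k : ℤ, k • g ∈ I.carrier → k = 0) ∧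
  ∀ a ∈ J.carrier, ∀ b : B, -(a + b) + (b + a) ∈ I.carrier ∧ -(a * b) + (a + b) ∈ I.carrier

theorem mk_mem_factor {I J : Ideal B} (hIJ : I ≤ J) {a : B} :
    (QuotientAddGroup.mk a : B ⧸ I.toAddSubgroup) ∈ factor I J ↔ a ∈ J.carrier := by
  constructor
  · rintro ⟨b, hb, hab⟩
    have h := hIJ (QuotientAddGroup.eq.mp hab)
    have := J.add_mem hb h
    rwa [add_neg_cancel_left] at this
  · exact fun h => ⟨a, h, rfl⟩

theorem factor_subset_socle_iff {I J : Ideal B} :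
    (factor I J : Set (B ⧸ I.toAddSubgroup)) ⊆ socle (B ⧸ I.toAddSubgroup) ↔
      ∀ a ∈ J.carrier, ∀ b : B,
        -(a + b) + (b + a) ∈ I.carrier ∧ -(a * b) + (a + b) ∈ I.carrier := by
  constructor
  · intro h a ha b
    have := mem_socle_iff.mp (h ⟨a, ha, rfl⟩) (QuotientAddGroup.mk b)
    exact ⟨QuotientAddGroup.eq.mp this.1, QuotientAddGroup.eq.mp this.2⟩
  · rintro h _ ⟨a, ha, rfl⟩
    rw [mem_socle_iff]
    rintro ⟨b⟩
    exact ⟨QuotientAddGroup.eq.mpr (h a ha b).1, QuotientAddGroup.eq.mpr (h a ha b).2⟩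

theorem socleStep_iff {I J : Ideal B} :
    SocleStep I J ↔ I ≤ J ∧ IsInfiniteCyclicSocleFactor I J := by
  unfold SocleStep IsInfiniteCyclicSocleFactor
  rw [factor_subset_socle_iff, ← and_assoc (a := IsAddCyclic _)]
  refine and_congr_right fun hIJ => and_congr_left fun _ => ?_
  constructor
  · rintro ⟨g, hg, h1, h2⟩
    let γ : factor I J := ⟨QuotientAddGroup.mk g, (mk_mem_factor hIJ).mpr hg⟩
    refine ⟨⟨γ, ?_⟩, Infinite.of_injective (fun k : ℤ => k • γ) ?_⟩
    · rintro ⟨_, x, hx, rfl⟩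
      obtain ⟨k, hk⟩ := h1 x hx
      exact ⟨k, Subtype.ext (QuotientAddGroup.eq.mpr hk)⟩
    · intro k m hkm
      have h : (k • (QuotientAddGroup.mk g : B ⧸ I.toAddSubgroup)) = m • QuotientAddGroup.mk g :=
        congrArg Subtype.val hkm
      have h : -(k • g) + m • g ∈ I.carrier := QuotientAddGroup.eq.mp h
      rw [← neg_zsmul, ← add_zsmul] at h
      have := h2 _ h
      omega
  · rintro ⟨⟨⟨γ, hγ⟩, hgen⟩, hinf⟩
    obtain ⟨g, hg, rfl⟩ := hγ
    refine ⟨g, hg, fun x hx => ?_, fun k hk => ?_⟩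
    · obtain ⟨k, hk⟩ := hgen ⟨QuotientAddGroup.mk x, (mk_mem_factor hIJ).mpr hx⟩
      exact ⟨k, QuotientAddGroup.eq.mp (congrArg Subtype.val hk)⟩
    · by_contra hk0
      refine not_finite_iff_infinite.mpr hinf ?_
      have hfin : IsOfFinAddOrder (⟨QuotientAddGroup.mk' _ g, g, hg, rfl⟩ : factor I J) := by
        rw [isOfFinAddOrder_iff_zsmul_eq_zero]
        exact ⟨k, hk0, Subtype.ext ((QuotientAddGroup.eq_zero_iff _).mpr hk)⟩
      have h := hfin.finite_zmultiples
      exact Set.finite_univ_iff.mp (h.subset fun x _ => hgen x)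

theorem primeStep_iff {p : ℕ} {I J : Ideal B} :
    PrimeStep p I J ↔ I ≤ J ∧ p.Prime ∧ Nat.card (factor I J) = p := by
  rw [card_factor]; rfl

/-- The preimage in `B` of an ideal of `B / E`. -/
def comap (E : Ideal B) (I : Ideal (B ⧸ E.toAddSubgroup)) : Ideal B where
  carrier := QuotientAddGroup.mk ⁻¹' I.carrier
  zero_mem := I.zero_mem
  add_mem := I.add_mem
  neg_mem := I.neg_mem
  mul_mem := I.mul_mem
  inv_mem := I.inv_mem
  lam_mem b _ := I.lam_mem (QuotientAddGroup.mk b)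
  add_conj_mem b _ := I.add_conj_mem (QuotientAddGroup.mk b)
  mul_conj_mem b _ := I.mul_conj_mem (QuotientAddGroup.mk b)

theorem comap_bot (E : Ideal B) : comap E ⊥ = E :=
  Ideal.ext (Set.ext fun _ => QuotientAddGroup.eq_zero_iff _)

theorem exists_comap_eq {E I : Ideal B} (h : E ≤ I) : ∃ I', comap E I' = I := by
  refine ⟨{
    carrier := factor E I
    zero_mem := (factor E I).zero_mem
    add_mem := (factor E I).add_mem
    neg_mem := (factor E I).neg_mem
    mul_mem := ?_
    inv_mem := ?_
    lam_mem := ?_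
    add_conj_mem := ?_
    mul_conj_mem := ?_ }, Ideal.ext (Set.ext fun _ => mk_mem_factor h)⟩
  · rintro _ _ ⟨a, ha, rfl⟩ ⟨b, hb, rfl⟩
    exact ⟨a * b, I.mul_mem ha hb, rfl⟩
  · rintro _ ⟨a, ha, rfl⟩
    exact ⟨a⁻¹, I.inv_mem ha, rfl⟩
  · rintro ⟨b⟩ _ ⟨a, ha, rfl⟩
    exact ⟨lam b a, I.lam_mem b ha, rfl⟩
  · rintro ⟨b⟩ _ ⟨a, ha, rfl⟩
    exact ⟨b + a + -b, I.add_conj_mem b ha, rfl⟩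
  · rintro ⟨b⟩ _ ⟨a, ha, rfl⟩
    exact ⟨b * a * b⁻¹, I.mul_conj_mem b ha, rfl⟩

theorem comap_le_comap_iff {E : Ideal B} {I J : Ideal (B ⧸ E.toAddSubgroup)} :
    comap E I ≤ comap E J ↔ I ≤ J :=
  Set.preimage_subset_preimage_iff (by
    rw [QuotientAddGroup.mk_surjective.range_eq]; exact Set.subset_univ _)

theorem primeStep_comap_iff {E : Ideal B} {p : ℕ} {I J : Ideal (B ⧸ E.toAddSubgroup)} :
    PrimeStep p (comap E I) (comap E J) ↔ PrimeStep p I J := by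
  unfold PrimeStep
  have h : (comap E I).toAddSubgroup.relIndex (comap E J).toAddSubgroup =
      I.toAddSubgroup.relIndex J.toAddSubgroup := by
    change (I.toAddSubgroup.comap (QuotientAddGroup.mk' _)).relIndex
      (J.toAddSubgroup.comap (QuotientAddGroup.mk' _)) = _
    rw [AddSubgroup.relIndex_comap, AddSubgroup.map_comap_eq_self_of_surjective
      (QuotientAddGroup.mk'_surjective _)]
  rw [comap_le_comap_iff, h]

theorem socleStep_comap_iff {E : Ideal B} {I J : Ideal (B ⧸ E.toAddSubgroup)} :
    SocleStep (comap E I) (comap E J) ↔ SocleStep I J := by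
  unfold SocleStep
  rw [comap_le_comap_iff]
  refine and_congr_right fun _ => and_congr ?_ ?_
  · constructor
    · rintro ⟨g, hg, h1, h2⟩
      refine ⟨QuotientAddGroup.mk g, hg, ?_, fun k hk => h2 k hk⟩
      rintro ⟨x⟩ hx
      exact h1 x hx
    · rintro ⟨⟨g⟩, hg, h1, h2⟩
      exact ⟨g, hg, fun x hx => h1 (QuotientAddGroup.mk x) hx, fun k hk => h2 k hk⟩
  · constructor
    · rintro h ⟨a⟩ ha ⟨b⟩
      exact h a ha b
    · intro h a ha b
      exact h (QuotientAddGroup.mk a) ha (QuotientAddGroup.mk b)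

theorem primeStep_comap_iff_bot {E : Ideal B} {p : ℕ} {J : Ideal (B ⧸ E.toAddSubgroup)} :
    PrimeStep p E (comap E J) ↔ PrimeStep p ⊥ J := by
  have h := primeStep_comap_iff (E := E) (p := p) (I := ⊥) (J := J)
  rwa [comap_bot] at h

theorem socleStep_comap_iff_bot {E : Ideal B} {J : Ideal (B ⧸ E.toAddSubgroup)} :
    SocleStep E (comap E J) ↔ SocleStep ⊥ J := by
  have h := socleStep_comap_iff (E := E) (I := ⊥) (J := J)
  rwa [comap_bot] at h

end Ideal

end SkewBrace

/-- A finite group of order `p * q`, with `q < p` and `p` prime, has at most one subgroup of order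
`p`. -/
@[to_additive /-- A finite additive group of order `p * q`, with `q < p` and `p` prime, has at most
one subgroup of order `p`. -/]
theorem Subgroup.eq_of_card_eq_prime {G : Type*} [Group G] {p q : ℕ} (hp : p.Prime) (hq : 0 < q)
    (hqp : q < p) {J H K : Subgroup G} (hJ : Nat.card J = p * q) (hH : Nat.card H = p)
    (hK : Nat.card K = p) (hHJ : H ≤ J) (hKJ : K ≤ J) : H = K := by
  have hindex : H.relIndex J = q := by
    have h := Subgroup.relIndex_mul_relIndex ⊥ H J bot_le hHJ
    rw [Subgroup.relIndex_bot_left, Subgroup.relIndex_bot_left, hH, hJ] at h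
    exact Nat.eq_of_mul_eq_mul_left hp.pos h
  have hle : H.relIndex K ≤ q := by
    have h := Subgroup.relIndex_le_of_le_right (H := H) hKJ (by omega)
    rwa [hindex] at h
  have hmul := Subgroup.relIndex_mul_relIndex ⊥ (H ⊓ K) K bot_le inf_le_right
  rw [Subgroup.relIndex_bot_left, Subgroup.relIndex_bot_left, Subgroup.inf_relIndex_right,
    hK] at hmul
  have h1 : H.relIndex K = 1 := by
    rcases (Nat.dvd_prime hp).mp (Dvd.intro_left _ hmul) with h | h
    · exact h
    · omega
  have hKH : K ≤ H := Subgroup.relIndex_eq_one.mp h1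
  have : Finite H := Nat.finite_of_card_ne_zero (by have := hp.pos; omega)
  exact (Subgroup.eq_of_le_of_card_ge hKH (by omega)).symm

namespace SkewBrace

namespace Ideal

variable {B : Type*} [SkewBrace B]

theorem bot_toAddSubgroup : (⊥ : Ideal B).toAddSubgroup = ⊥ := rfl

theorem bot_le (I : Ideal B) : (⊥ : Ideal B) ≤ I := by
  rintro a rfl
  exact I.zero_mem

theorem primeStep_bot_iff {p : ℕ} {I : Ideal B} :
    PrimeStep p ⊥ I ↔ p.Prime ∧ Nat.card I.toAddSubgroup = p := by
  unfold PrimeStep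
  rw [bot_toAddSubgroup, AddSubgroup.relIndex_bot_left]
  exact and_iff_right I.bot_le

theorem le_trans {I J K : Ideal B} (h1 : I ≤ J) (h2 : J ≤ K) : I ≤ K :=
  fun _ ha => h2 (h1 ha)

/-- Conjugation by `b` in the additive group. -/
def addConj (b : B) : B ≃+ B where
  toFun a := b + a + -b
  invFun a := -b + a + b
  left_inv a := by simp [add_assoc]
  right_inv a := by simp [add_assoc]
  map_add' a c := by simp [add_assoc]

theorem exists_primeStep_of_lt_bot {p q : ℕ} (hqp : q < p) {I J : Ideal B}
    (h1 : PrimeStep q ⊥ I) (h2 : PrimeStep p I J) :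
    ∃ K, PrimeStep p ⊥ K ∧ PrimeStep q K J := by
  obtain ⟨hq, hI⟩ := primeStep_bot_iff.mp h1
  obtain ⟨hIJ, hp, hindex⟩ := h2
  have hJ : Nat.card J.toAddSubgroup = p * q := by
    have h := AddSubgroup.relIndex_mul_relIndex ⊥ I.toAddSubgroup J.toAddSubgroup _root_.bot_le hIJ
    rw [AddSubgroup.relIndex_bot_left, AddSubgroup.relIndex_bot_left, hI, hindex] at h
    rw [← h, mul_comm]
  have : Fact p.Prime := ⟨hp⟩
  have : Finite J.toAddSubgroup :=
    Nat.finite_of_card_ne_zero (by rw [hJ]; exact (Nat.mul_pos hp.pos hq.pos).ne')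
  obtain ⟨⟨t, htJ⟩, ht⟩ := exists_prime_addOrderOf_dvd_card' (G := J.toAddSubgroup) p
    (by rw [hJ]; exact Dvd.intro _ rfl)
  rw [AddSubgroup.addOrderOf_mk] at ht
  let P : AddSubgroup B := AddSubgroup.zmultiples t
  have hP : Nat.card P = p := by rw [Nat.card_zmultiples, ht]
  have hPJ : P ≤ J.toAddSubgroup := AddSubgroup.zmultiples_le_of_mem htJ
  have hinv : ∀ f : B ≃+ B, (∀ a ∈ J.carrier, f a ∈ J.carrier) → ∀ a ∈ P, f a ∈ P := by
    intro f hf a ha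
    have h : P.map (f : B →+ B) = P :=
      AddSubgroup.eq_of_card_eq_prime hp hq.pos hqp hJ
        ((Nat.card_congr (P.equivMapOfInjective _ f.injective).toEquiv.symm).trans hP) hP
        (by rintro _ ⟨x, hx, rfl⟩; exact hf x (hPJ hx)) hPJ
    rw [← h]
    exact ⟨a, ha, rfl⟩
  have hlam : ∀ b : B, ∀ a ∈ P, lam b a ∈ P := fun b => hinv (lam b) fun a => J.lam_mem b
  have hadd : ∀ b : B, ∀ a ∈ P, b + a + -b ∈ P :=
    fun b => hinv (addConj b) fun a => J.add_conj_mem b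
  let M : Subgroup B :=
    { carrier := P
      one_mem' := by rw [one_eq_zero]; exact P.zero_mem
      mul_mem' := fun {a b} ha hb => by
        rw [mul_eq_add_lam]; exact P.add_mem ha (hlam a b hb)
      inv_mem' := fun {a} ha => by rw [inv_eq_neg_lam]; exact P.neg_mem (hlam _ a ha) }
  have hM : Nat.card M = p := hP
  have hmul : ∀ b : B, ∀ a ∈ P, b * a * b⁻¹ ∈ P := by
    intro b a ha
    have h : M.map (MulAut.conj b : B ≃* B).toMonoidHom = M :=
      Subgroup.eq_of_card_eq_prime (J := J.toSubgroup) hp hq.pos hqp hJ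
        ((Nat.card_congr (M.equivMapOfInjective _ (MulAut.conj b).injective).toEquiv.symm).trans hM)
        hM (by rintro _ ⟨x, hx, rfl⟩; exact J.mul_conj_mem b (hPJ hx)) hPJ
    change b * a * b⁻¹ ∈ M
    rw [← h]
    exact ⟨a, ha, rfl⟩
  refine ⟨ofAddSubgroup P hlam hadd hmul, primeStep_bot_iff.mpr ⟨hp, hP⟩, hPJ, hq, ?_⟩
  have h := AddSubgroup.relIndex_mul_relIndex ⊥ P J.toAddSubgroup _root_.bot_le hPJ
  rw [AddSubgroup.relIndex_bot_left, AddSubgroup.relIndex_bot_left, hP, hJ] at h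
  exact Nat.eq_of_mul_eq_mul_left hp.pos h

theorem exists_primeStep_of_lt {p q : ℕ} (hqp : q < p) {E I J : Ideal B}
    (h1 : PrimeStep q E I) (h2 : PrimeStep p I J) :
    ∃ K, PrimeStep p E K ∧ PrimeStep q K J := by
  obtain ⟨I, rfl⟩ := exists_comap_eq h1.1
  obtain ⟨J, rfl⟩ := exists_comap_eq (le_trans h1.1 h2.1)
  obtain ⟨K, hK1, hK2⟩ := exists_primeStep_of_lt_bot hqp (primeStep_comap_iff_bot.mp h1)
    (primeStep_comap_iff.mp h2)
  exact ⟨comap E K, primeStep_comap_iff_bot.mpr hK1, primeStep_comap_iff.mpr hK2⟩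

theorem socleStep_bot_iff {J : Ideal B} :
    SocleStep ⊥ J ↔ (∃ g ∈ J.carrier, (∀ x ∈ J.carrier, ∃ k : ℤ, x = k • g) ∧
      ∀ k : ℤ, k • g = 0 → k = 0) ∧ J.carrier ⊆ socle B := by
  unfold SocleStep
  simp only [mem_bot, neg_add_eq_zero]
  constructor
  · rintro ⟨-, ⟨g, hg, h1, h2⟩, h3⟩
    refine ⟨⟨g, hg, fun x hx => (h1 x hx).imp fun k hk => hk.symm, h2⟩, fun a ha => ?_⟩
    exact mem_socle_iff.mpr (h3 a ha)
  · rintro ⟨⟨g, hg, h1, h2⟩, h3⟩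
    refine ⟨J.bot_le, ⟨g, hg, fun x hx => (h1 x hx).imp fun k hk => hk.symm, h2⟩, fun a ha => ?_⟩
    exact mem_socle_iff.mp (h3 ha)

theorem exists_of_primeStep_two_bot {I : Ideal B} (h : PrimeStep 2 ⊥ I) :
    ∃ e ∈ I.carrier, e ≠ 0 ∧ e + e = 0 ∧ ∀ c ∈ I.carrier, c = 0 ∨ c = e := by
  obtain ⟨x, y, hxy, huniv⟩ := Nat.card_eq_two_iff.mp (primeStep_bot_iff.mp h).2
  have hmem : ∀ c : I.toAddSubgroup, c = x ∨ c = y := fun c => by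
    have : c ∈ ({x, y} : Set _) := huniv ▸ Set.mem_univ c
    simpa using this
  have key : ∃ e : I.toAddSubgroup, e ≠ 0 ∧ ∀ c : I.toAddSubgroup, c = 0 ∨ c = e := by
    rcases hmem 0 with h0 | h0
    · exact ⟨y, h0 ▸ hxy.symm, fun c => h0 ▸ hmem c⟩
    · exact ⟨x, h0 ▸ hxy, fun c => h0 ▸ (hmem c).symm⟩
  obtain ⟨e, he, hc⟩ := key
  refine ⟨e, e.2, fun h => he (Subtype.ext h), ?_, fun c hcI => ?_⟩
  · rcases hc (e + e) with h | h
    · exact congrArg Subtype.val h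
    · exact absurd (left_eq_add.mp h.symm) he
  · exact (hc ⟨c, hcI⟩).imp (congrArg Subtype.val) (congrArg Subtype.val)

/-- An ideal of order two lies in the socle. -/
theorem le_socle_of_primeStep_two {I : Ideal B} (h : PrimeStep 2 ⊥ I) : I.carrier ⊆ socle B := by
  obtain ⟨e, heI, he, -, hI⟩ := exists_of_primeStep_two_bot h
  have hfix : ∀ b : B, lam b e = e := fun b =>
    (hI _ (I.lam_mem b heI)).resolve_left fun h => he ((lam b).map_eq_zero_iff.mp h)
  have hadd : ∀ b : B, b + e = e + b := fun b => by
    have h := (hI _ (I.add_conj_mem b heI)).resolve_left fun h =>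
      he ((addConj b).map_eq_zero_iff.mp h)
    rwa [add_neg_eq_iff_eq_add] at h
  have hmul : ∀ b : B, b * e = e * b := fun b => by
    have h := (hI _ (I.mul_conj_mem b heI)).resolve_left fun h => he (by
      rw [← one_eq_zero, conj_eq_one_iff] at h
      rw [h, one_eq_zero])
    rwa [mul_inv_eq_iff_eq_mul] at h
  intro c hc
  rcases hI c hc with rfl | rfl
  · exact (socleAddSubgroup B).zero_mem
  · exact mem_socle_iff.mpr fun b =>
      ⟨(hadd b).symm, by rw [← hmul, mul_eq_add_lam, hfix, hadd]⟩

theorem exists_socleStep_of_primeStep_two_bot {I J : Ideal B} (h1 : PrimeStep 2 ⊥ I)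
    (h2 : SocleStep I J) :
    ∃ K L, SocleStep ⊥ K ∧ PrimeStep 2 K L ∧ PrimeStep 2 L J := by
  obtain ⟨e, heI, he, hee, hI⟩ := exists_of_primeStep_two_bot h1
  have hIsoc := le_socle_of_primeStep_two h1
  have hcc : ∀ c ∈ I.carrier, c + c = 0 := fun c hc => by
    rcases hI c hc with rfl | rfl
    · exact add_zero 0
    · exact hee
  have hcomm : ∀ c ∈ I.carrier, ∀ b : B, c + b = b + c :=
    fun c hc b => (mem_socle_iff.mp (hIsoc hc) b).1
  obtain ⟨hIJ, ⟨g, hg, hgen, hinf⟩, hsoc⟩ := h2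
  have hlamg : ∀ b : B, ∃ c ∈ I.carrier, lam g b = b + c := fun b => by
    refine ⟨-b + lam g b, ?_, by rw [add_neg_cancel_left]⟩
    have h := I.neg_mem (hsoc g hg b).2
    rw [neg_add_rev, neg_neg, neg_add_rev, add_assoc] at h
    exact h
  have hfix : ∀ c ∈ I.carrier, lam g c = c := fun c hc => by
    have h0 : ∀ x, lam g x = 0 → x = 0 := fun x => (lam g).map_eq_zero_iff.mp
    have hmem := I.lam_mem g hc
    rcases hI c hc with rfl | rfl
    · exact map_zero _
    · exact (hI _ hmem).resolve_left fun h => he (h0 _ h)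
  have hlamgg : ∀ b : B, lam (g * g) b = b := fun b => by
    obtain ⟨c, hc, hb⟩ := hlamg b
    rw [lam_mul_apply, hb, map_add, hb, hfix c hc, add_assoc, hcc c hc, add_zero]
  let s : B := (2 : ℤ) • g
  have hs2 : s = g + g := two_zsmul g
  have hs : s ∈ socle B := by
    rw [mem_socle_iff]
    intro b
    constructor
    · obtain ⟨c, hc, hb⟩ : ∃ c ∈ I.carrier, b + g = g + b + c :=
        ⟨_, (hsoc g hg b).1, (add_neg_cancel_left _ _).symm⟩
      rw [hs2]
      calc g + g + b = g + g + b + (c + c) := by rw [hcc c hc, add_zero]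
        _ = g + (g + b + c) + c := by simp only [add_assoc]
        _ = g + b + (g + c) := by rw [← hb]; simp only [add_assoc]
        _ = (g + b + c) + g := by rw [← hcomm c hc g, add_assoc (g + b)]
        _ = b + (g + g) := by rw [← hb, add_assoc]
    · obtain ⟨c, hc, hgc⟩ := hlamg g
      have hs' : s = g * g * c := by
        rw [mul_eq_add_lam (g * g), hlamgg, mul_eq_add_lam g g, hgc, add_assoc, add_assoc g c c,
          hcc c hc, add_zero, hs2]
      have hlams : lam s b = b := by
        rw [hs', lam_mul_apply, lam_of_mem_socle (hIsoc hc), hlamgg]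
      rw [mul_eq_add_lam, hlams]
  have hgenJ : ∀ x ∈ J.carrier, ∃ k : ℤ, ∃ c ∈ I.carrier, x = k • g + c := fun x hx => by
    obtain ⟨k, hk⟩ := hgen x hx
    exact ⟨k, _, hk, (add_neg_cancel_left _ _).symm⟩
  have hlams : ∀ b : B, ∃ m : ℤ, lam b s = m • s := fun b => by
    obtain ⟨m, c, hc, hm⟩ := hgenJ _ (J.lam_mem b hg)
    refine ⟨m, ?_⟩
    rw [hs2, map_add, hm, add_assoc, ← add_assoc c, hcomm c hc, add_assoc, hcc c hc, add_zero,
      ← add_zsmul, ← mul_two, mul_zsmul, two_zsmul]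
  have hsinf : ∀ k : ℤ, k • s ∈ I.carrier → k = 0 := fun k hk => by
    have := hinf (k * 2) (by rw [mul_zsmul]; exact hk)
    omega
  let P : AddSubgroup B := AddSubgroup.zmultiples s
  have hP : P ≤ socleAddSubgroup B := AddSubgroup.zmultiples_le_of_mem hs
  have hPlam : ∀ b : B, ∀ a ∈ P, lam b a ∈ P := by
    rintro b _ ⟨k, rfl⟩
    obtain ⟨m, hm⟩ := hlams b
    change lam b (k • s) ∈ P
    rw [map_zsmul, hm]
    exact P.zsmul_mem (P.zsmul_mem (AddSubgroup.mem_zmultiples s) m) k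
  let Q : AddSubgroup B := P ⊔ I.toAddSubgroup
  have hmemQ : ∀ {x : B}, x ∈ Q ↔ ∃ k : ℤ, ∃ c ∈ I.carrier, k • s + c = x := fun {x} => by
    rw [AddSubgroup.mem_sup_of_normal_right]
    constructor
    · rintro ⟨_, ⟨k, rfl⟩, c, hc, h⟩
      exact ⟨k, c, hc, h⟩
    · rintro ⟨k, c, hc, h⟩
      exact ⟨_, ⟨k, rfl⟩, c, hc, h⟩
  have hQ : Q ≤ socleAddSubgroup B := sup_le hP hIsoc
  have hQlam : ∀ b : B, ∀ a ∈ Q, lam b a ∈ Q := fun b a ha => by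
    obtain ⟨k, c, hc, rfl⟩ := hmemQ.mp ha
    rw [map_add]
    exact Q.add_mem ((le_sup_left : P ≤ Q) (hPlam b _ ⟨k, rfl⟩))
      ((le_sup_right : I.toAddSubgroup ≤ Q) (I.lam_mem b hc))
  refine ⟨ofLeSocle P hP hPlam, ofLeSocle Q hQ hQlam, socleStep_bot_iff.mpr
    ⟨⟨s, AddSubgroup.mem_zmultiples s, ?_, fun k hk => hsinf k (hk ▸ I.zero_mem)⟩, hP⟩,
    ⟨(le_sup_left : P ≤ Q), Nat.prime_two, ?_⟩, ⟨?_, Nat.prime_two, ?_⟩⟩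
  · rintro _ ⟨k, rfl⟩
    exact ⟨k, rfl⟩
  · change P.relIndex Q = 2
    have heP : e ∉ P := by
      rintro ⟨k, hk⟩
      change k • s = e at hk
      rw [hsinf k (hk ▸ heI), zero_zsmul] at hk
      exact he hk.symm
    refine AddSubgroup.relIndex_eq_two_iff.mpr ⟨e, (le_sup_right : I.toAddSubgroup ≤ Q) heI, ?_⟩
    intro b hb
    obtain ⟨k, c, hc, rfl⟩ := hmemQ.mp hb
    have hk : k • s ∈ P := ⟨k, rfl⟩
    rcases hI c hc with rfl | rfl
    · rw [add_zero, P.add_mem_cancel_left hk]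
      exact Or.inr ⟨hk, heP⟩
    · rw [add_assoc, hee, add_zero, P.add_mem_cancel_left hk]
      exact Or.inl ⟨hk, heP⟩
  · intro x hx
    obtain ⟨k, c, hc, rfl⟩ := hmemQ.mp hx
    exact J.add_mem (J.zsmul_mem (J.zsmul_mem hg 2) k) (hIJ hc)
  · change Q.relIndex J.toAddSubgroup = 2
    have heven : ∀ (n : ℤ), ∀ c ∈ I.carrier, n • g + c ∈ Q ↔ Even n := by
      intro n c hc
      rw [hmemQ]
      constructor
      · rintro ⟨k, d, hd, h⟩
        have h' : (n - k * 2) • g ∈ I.carrier := by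
          have h2 : (n - k * 2) • g = d + -c := by
            rw [sub_eq_neg_add, add_zsmul, neg_zsmul, mul_zsmul]
            change -(k • s) + n • g = _
            rw [neg_add_eq_iff_eq_add, ← add_assoc, h, add_neg_cancel_right]
          rw [h2]
          exact I.add_mem hd (I.neg_mem hc)
        exact ⟨k, by have := hinf _ h'; omega⟩
      · rintro ⟨k, rfl⟩
        exact ⟨k, c, hc, by rw [← mul_two, mul_zsmul]⟩
    refine AddSubgroup.relIndex_eq_two_iff.mpr ⟨g, hg, fun b hb => ?_⟩
    obtain ⟨n, c, hc, rfl⟩ := hgenJ b hb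
    rw [add_assoc, hcomm c hc, ← add_assoc, ← add_one_zsmul, heven _ c hc, heven _ c hc,
      Int.even_add_one]
    by_cases h : Even n
    · exact Or.inr ⟨h, fun h' => h' h⟩
    · exact Or.inl ⟨h, h⟩

theorem exists_socleStep_of_primeStep_two {E I J : Ideal B} (h1 : PrimeStep 2 E I)
    (h2 : SocleStep I J) :
    ∃ K L, SocleStep E K ∧ PrimeStep 2 K L ∧ PrimeStep 2 L J := by
  obtain ⟨I, rfl⟩ := exists_comap_eq h1.1
  obtain ⟨J, rfl⟩ := exists_comap_eq (le_trans h1.1 h2.1)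
  obtain ⟨K, L, hK, hL, hJ⟩ := exists_socleStep_of_primeStep_two_bot
    (primeStep_comap_iff_bot.mp h1) (socleStep_comap_iff.mp h2)
  exact ⟨comap E K, comap E L, socleStep_comap_iff_bot.mpr hK, primeStep_comap_iff.mpr hL,
    primeStep_comap_iff.mpr hJ⟩

end Ideal

variable {B : Type*} [SkewBrace B]

theorem pow_eq_nsmul_of_mem_socle {a : B} (ha : a ∈ socle B) (n : ℕ) : a ^ n = n • a := by
  induction n with
  | zero => rw [pow_zero, zero_nsmul, one_eq_zero]
  | succ n ih => rw [pow_succ', ih, (mem_socle_iff.mp ha _).2, succ_nsmul']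

namespace Ideal

theorem PrimeStep.exists_not_mem {p : ℕ} {I J : Ideal B} (h : PrimeStep p I J) :
    ∃ t ∈ J.carrier, t ∉ I.carrier := by
  obtain ⟨-, hp, hindex⟩ := h
  by_contra! hcon
  have h1 : I.toAddSubgroup.relIndex J.toAddSubgroup = 1 := AddSubgroup.relIndex_eq_one.mpr hcon
  exact hp.one_lt.ne (h1.symm.trans hindex)

/-- Any element outside `I` generates a factor `J / I` of prime order. -/
theorem PrimeStep.exists_zsmul {p : ℕ} {I J : Ideal B} (h : PrimeStep p I J) {t : B}
    (htJ : t ∈ J.carrier) (htI : t ∉ I.carrier) {x : B} (hx : x ∈ J.carrier) :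
    ∃ k : ℤ, ∃ i ∈ I.carrier, x = k • t + i := by
  obtain ⟨-, hp, hindex⟩ := h
  have : Fact p.Prime := ⟨hp⟩
  let N := I.toAddSubgroup.addSubgroupOf J.toAddSubgroup
  have hcard : Nat.card (J.toAddSubgroup ⧸ N) = p := hindex
  have hne : (QuotientAddGroup.mk ⟨t, htJ⟩ : J.toAddSubgroup ⧸ N) ≠ 0 := fun h =>
    htI ((QuotientAddGroup.eq_zero_iff _).mp h)
  obtain ⟨k, hk⟩ := mem_zmultiples_of_prime_card hcard hne
    (g' := QuotientAddGroup.mk ⟨x, hx⟩)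
  have hk' : -(k • t) + x ∈ I.carrier := QuotientAddGroup.eq.mp hk
  exact ⟨k, _, hk', (add_neg_cancel_left _ _).symm⟩

section

variable {I J : Ideal B} {p : ℕ} {z : B}

theorem lam_eq_self_of_odd_index (hp2 : Odd p) (h2 : PrimeStep p I J) (hI : I.carrier ⊆ socle B)
    (hz : z ∈ I.carrier) (hgen : ∀ x ∈ I.carrier, ∃ k : ℤ, x = k • z)
    (hinf : ∀ k : ℤ, k • z = 0 → k = 0) {b : B} (hb : b ∈ J.carrier) {i : B}
    (hi : i ∈ I.carrier) : lam b i = i := by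
  have hinj : ∀ k : ℤ, k • z = z → k = 1 := fun k hk => by
    have := hinf (k - 1) (by rw [sub_zsmul, hk, one_zsmul, add_neg_cancel])
    omega
  suffices h : lam b z = z by
    obtain ⟨k, rfl⟩ := hgen i hi
    rw [map_zsmul, h]
  obtain ⟨k, hk⟩ := hgen _ (I.lam_mem b hz)
  obtain ⟨m, hm⟩ := hgen _ (I.lam_mem b⁻¹ hz)
  have hkm : m * k = 1 := hinj _ (by
    have h := lam_apply_lam_inv b z
    rwa [hm, map_zsmul, hk, ← mul_zsmul] at h)
  rcases Int.isUnit_iff.mp (IsUnit.of_mul_eq_one_right m hkm) with rfl | rfl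
  · rw [hk, one_zsmul]
  · exfalso
    have hpow : ∀ n : ℕ, lam (b ^ n) z = ((-1) ^ n : ℤ) • z := by
      intro n
      induction n with
      | zero => rw [pow_zero, pow_zero, lam_apply, one_mul, one_eq_zero, neg_zero, zero_add,
          one_zsmul]
      | succ n ih => rw [pow_succ', lam_mul_apply, ih, map_zsmul, hk, ← mul_zsmul, pow_succ]
    have hbp : b ^ p ∈ I.carrier := by
      have h := Subgroup.pow_relIndex_mem I.toSubgroup (K := J.toSubgroup) (g := b) hb
      rwa [relIndex_toSubgroup, h2.2.2] at h
    have h := hpow p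
    rw [lam_of_mem_socle (hI hbp), hp2.neg_one_pow] at h
    have := hinj _ h.symm
    omega

/-- If an ideal of odd prime index over an infinite cyclic ideal in the socle is generated by a
`p`-th root of the generator, then it lies in the socle. -/
theorem socleStep_of_zsmul_eq (hp2 : Odd p) (h2 : PrimeStep p I J) (hI : I.carrier ⊆ socle B)
    (hz : z ∈ I.carrier) (hgen : ∀ x ∈ I.carrier, ∃ k : ℤ, x = k • z)
    (hinf : ∀ k : ℤ, k • z = 0 → k = 0) {h : B} (hh : h ∈ J.carrier) (hphz : (p : ℤ) • h = z) :
    SocleStep ⊥ J := by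
  have hinj : ∀ k m : ℤ, k • z = m • z → k = m := fun k m hkm => by
    have := hinf (k - m) (by rw [sub_zsmul, hkm, add_neg_cancel])
    omega
  have hhI : h ∉ I.carrier := fun hmem => by
    obtain ⟨k, hk⟩ := hgen h hmem
    have h1 := hinj 1 (p * k) (by rw [mul_zsmul, ← hk, hphz, one_zsmul])
    have := Int.eq_one_or_neg_one_of_mul_eq_one h1.symm
    have := h2.2.1.one_lt
    omega
  have hgenJ : ∀ x ∈ J.carrier, ∃ k : ℤ, x = k • h := fun x hx => by
    obtain ⟨k, i, hi, rfl⟩ := h2.exists_zsmul hh hhI hx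
    obtain ⟨n, rfl⟩ := hgen i hi
    exact ⟨k + n * p, by rw [add_zsmul, mul_zsmul, hphz]⟩
  have hcoef : ∀ (f : B ≃+ B) (k : ℤ), f h = k • h → f z = k • z := fun f k hf => by
    rw [← hphz, map_zsmul, hf, ← mul_zsmul, ← mul_zsmul, mul_comm]
  have hlamJ : ∀ b ∈ J.carrier, ∀ x ∈ J.carrier, lam b x = x := fun b hb x hx => by
    obtain ⟨k, rfl⟩ := hgenJ x hx
    obtain ⟨n, hn⟩ := hgenJ _ (J.lam_mem b hh)
    have h1 := hcoef _ _ hn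
    rw [lam_eq_self_of_odd_index hp2 h2 hI hz hgen hinf hb hz] at h1
    rw [map_zsmul, hn, ← hinj 1 n (by rw [one_zsmul, ← h1]), one_zsmul]
  have hpowJ : ∀ x ∈ J.carrier, ∀ n : ℕ, x ^ n = n • x := fun x hx n => by
    induction n with
    | zero => rw [pow_zero, zero_nsmul, one_eq_zero]
    | succ n ih =>
      rw [pow_succ', ih, mul_eq_add_lam, hlamJ x hx _ (J.toAddSubgroup.nsmul_mem hx n),
        succ_nsmul']
  have hsoc : h ∈ socle B := by
    rw [mem_socle_iff]
    intro b
    have hcomm : b + h = h + b := by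
      obtain ⟨n, hn⟩ := hgenJ _ (J.add_conj_mem b hh)
      have h1 := hcoef (addConj b) n hn
      have hzb : addConj b z = z := by
        change b + z + -b = z
        rw [← (mem_socle_iff.mp (hI hz) b).1, add_neg_cancel_right]
      rw [← hinj 1 n (by rw [one_zsmul, ← h1, hzb]), one_zsmul, add_neg_eq_iff_eq_add] at hn
      exact hn
    refine ⟨hcomm.symm, ?_⟩
    have hconj : b⁻¹ * h * b = lam b⁻¹ h := by
      have hmem := J.mul_conj_mem b⁻¹ hh
      have hpow : (b⁻¹ * h * b⁻¹⁻¹) ^ p = lam b⁻¹ z := by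
        rw [conj_pow, hpowJ h hh, ← natCast_zsmul, hphz, conj_of_mem_socle (hI hz)]
      rw [hpowJ _ hmem] at hpow
      rw [inv_inv] at hmem hpow
      obtain ⟨n, hn⟩ := hgenJ _ hmem
      obtain ⟨m, hm⟩ := hgenJ _ (J.lam_mem b⁻¹ hh)
      rw [hn, hcoef _ _ hm, ← natCast_zsmul, ← mul_zsmul, mul_comm, mul_zsmul, hphz] at hpow
      rw [hn, hm, hinj _ _ hpow]
    rw [← hcomm]
    calc h * b = b * (b⁻¹ * h * b) := by group
      _ = b + h := by rw [hconj, mul_eq_add_lam, lam_apply_lam_inv]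
  refine socleStep_bot_iff.mpr ⟨⟨h, hh, hgenJ, fun k hk => hinf k ?_⟩, fun x hx => ?_⟩
  · rw [← hphz, ← mul_zsmul, mul_comm, mul_zsmul, hk, zsmul_zero]
  · obtain ⟨k, rfl⟩ := hgenJ x hx
    exact (socleAddSubgroup B).zsmul_mem hsoc k

/-- If an ideal of odd prime index `p` over an infinite cyclic ideal in the socle has an element of
additive order `p`, then its `p`-torsion is an ideal. -/
theorem exists_primeStep_of_zsmul_eq_zero (hp2 : Odd p) (h2 : PrimeStep p I J)
    (hI : I.carrier ⊆ socle B) (hz : z ∈ I.carrier) (hgen : ∀ x ∈ I.carrier, ∃ k : ℤ, x = k • z)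
    (hinf : ∀ k : ℤ, k • z = 0 → k = 0) {t : B} (htJ : t ∈ J.carrier) (htI : t ∉ I.carrier)
    (hpt : (p : ℤ) • t = 0) : ∃ K, PrimeStep p ⊥ K ∧ SocleStep K J := by
  have hp := h2.2.1
  have : Fact p.Prime := ⟨hp⟩
  have hp0 : (p : ℤ) ≠ 0 := by exact_mod_cast hp.ne_zero
  have hc : ∀ i ∈ I.carrier, ∀ b, AddCommute i b := fun i hi b => (mem_socle_iff.mp (hI hi) b).1
  have hItors : ∀ i ∈ I.carrier, (p : ℤ) • i = 0 → i = 0 := fun i hi h => by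
    obtain ⟨n, rfl⟩ := hgen i hi
    rw [← mul_zsmul] at h
    rw [(mul_eq_zero.mp (hinf _ h)).resolve_left hp0, zero_zsmul]
  let T : AddSubgroup B := AddSubgroup.zmultiples t
  have hTcard : Nat.card T = p := by
    rw [Nat.card_zmultiples]
    refine addOrderOf_eq_prime ?_ fun h => htI (h ▸ I.zero_mem)
    rw [← natCast_zsmul, hpt]
  have hTJ : T ≤ J.toAddSubgroup := AddSubgroup.zmultiples_le_of_mem htJ
  have hdecomp : ∀ x ∈ J.carrier, ∃ τ ∈ T, ∃ i ∈ I.carrier, x = τ + i := fun x hx => by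
    obtain ⟨k, i, hi, rfl⟩ := h2.exists_zsmul htJ htI hx
    exact ⟨_, ⟨k, rfl⟩, i, hi, rfl⟩
  have hTtors : ∀ τ ∈ T, (p : ℤ) • τ = 0 := by
    rintro _ ⟨k, rfl⟩
    change (p : ℤ) • k • t = 0
    rw [← mul_zsmul, mul_comm, mul_zsmul, hpt, zsmul_zero]
  have hTmem : ∀ x ∈ J.carrier, (p : ℤ) • x = 0 → x ∈ T := fun x hx hpx => by
    obtain ⟨τ, hτ, i, hi, rfl⟩ := hdecomp x hx
    rw [(hc i hi τ).symm.zsmul_add, hTtors τ hτ, zero_add] at hpx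
    rwa [hItors i hi hpx, add_zero]
  have hinv : ∀ f : B ≃+ B, (∀ a ∈ J.carrier, f a ∈ J.carrier) → ∀ a ∈ T, f a ∈ T :=
    fun f hf a ha => hTmem _ (hf a (hTJ ha)) (by rw [← map_zsmul, hTtors a ha, map_zero])
  have hlam : ∀ b : B, ∀ a ∈ T, lam b a ∈ T := fun b => hinv (lam b) fun a => J.lam_mem b
  have hadd : ∀ b : B, ∀ a ∈ T, b + a + -b ∈ T :=
    fun b => hinv (addConj b) fun a => J.add_conj_mem b
  let M : Subgroup B :=
    { carrier := T
      one_mem' := by rw [one_eq_zero]; exact T.zero_mem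
      mul_mem' := fun {a b} ha hb => by
        rw [mul_eq_add_lam]; exact T.add_mem ha (hlam a b hb)
      inv_mem' := fun {a} ha => by rw [inv_eq_neg_lam]; exact T.neg_mem (hlam _ a ha) }
  have hMcard : Nat.card M = p := hTcard
  have hMtors : ∀ τ ∈ T, τ ^ p = 1 := fun τ hτ => by
    have h : (⟨τ, hτ⟩ : M) ^ Nat.card M = 1 := pow_card_eq_one'
    rw [hMcard] at h
    exact congrArg Subtype.val h
  have hadd_eq_mul : ∀ τ ∈ T, ∀ i ∈ I.carrier, τ + i = i * τ ∧ Commute τ i := fun τ hτ i hi => by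
    have h1 : τ * i = τ + i := by
      rw [mul_eq_add_lam, lam_eq_self_of_odd_index hp2 h2 hI hz hgen hinf (hTJ hτ) hi]
    have h2 : i * τ = τ + i := by
      rw [(mem_socle_iff.mp (hI hi) τ).2]
      exact hc i hi τ
    exact ⟨h2.symm, h1.trans h2.symm⟩
  have hmul : ∀ b : B, ∀ a ∈ T, b * a * b⁻¹ ∈ T := fun b a ha => by
    obtain ⟨τ, hτ, i, hi, hx⟩ := hdecomp _ (J.mul_conj_mem b (hTJ ha))
    have hpow : (b * a * b⁻¹) ^ p = 1 := by rw [conj_pow, hMtors a ha, mul_one, mul_inv_cancel]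
    obtain ⟨h1, h2⟩ := hadd_eq_mul τ hτ i hi
    rw [hx, h1, h2.symm.mul_pow, hMtors τ hτ, mul_one, pow_eq_nsmul_of_mem_socle (hI hi),
      one_eq_zero, ← natCast_zsmul] at hpow
    rw [hx, hItors i hi hpow, add_zero]
    exact hτ
  let K := ofAddSubgroup T hlam hadd hmul
  have hKJ : K ≤ J := hTJ
  refine ⟨K, primeStep_bot_iff.mpr ⟨hp, hTcard⟩, hKJ, ⟨z, h2.1 hz, fun x hx => ?_, fun k hk => ?_⟩,
    factor_subset_socle_iff.mp ?_⟩
  · obtain ⟨τ, hτ, i, hi, rfl⟩ := hdecomp x hx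
    obtain ⟨n, rfl⟩ := hgen i hi
    refine ⟨n, ?_⟩
    rw [← (hc _ hi τ).eq, neg_add_cancel_left]
    exact hτ
  · have h := hTtors _ hk
    rw [← mul_zsmul] at h
    exact (mul_eq_zero.mp (hinf _ h)).resolve_left hp0
  · rintro _ ⟨a, ha, rfl⟩
    obtain ⟨τ, hτ, i, hi, rfl⟩ := hdecomp a ha
    have hmk : QuotientAddGroup.mk' K.toAddSubgroup (τ + i) = QuotientAddGroup.mk i := by
      refine (QuotientAddGroup.eq.mpr ?_).symm
      rw [← (hc i hi τ).eq, neg_add_cancel_left]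
      exact hτ
    rw [hmk, mem_socle_iff]
    rintro ⟨b⟩
    exact ⟨congrArg QuotientAddGroup.mk (hc i hi b).eq,
      congrArg QuotientAddGroup.mk (mem_socle_iff.mp (hI hi) b).2⟩

end

theorem socleStep_or_exists_primeStep_bot {p : ℕ} (hp2 : Odd p) {I J : Ideal B}
    (h1 : SocleStep ⊥ I) (h2 : PrimeStep p I J) :
    SocleStep ⊥ J ∨ ∃ K, PrimeStep p ⊥ K ∧ SocleStep K J := by
  obtain ⟨⟨z, hz, hgen, hinf⟩, hI⟩ := socleStep_bot_iff.mp h1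
  obtain ⟨t, htJ, htI⟩ := h2.exists_not_mem
  have hzt : AddCommute z t := (mem_socle_iff.mp (hI hz) t).1
  have hpt : (p : ℤ) • t ∈ I.carrier := by
    have h := AddSubgroup.nsmul_relIndex_mem I.toAddSubgroup (K := J.toAddSubgroup) (g := t) htJ
    rwa [h2.2.2, ← natCast_zsmul] at h
  obtain ⟨m, hm⟩ := hgen _ hpt
  by_cases hdvd : (p : ℤ) ∣ m
  · obtain ⟨n, rfl⟩ := hdvd
    have hnz : n • z ∈ I.carrier := I.zsmul_mem hz n
    right
    refine exists_primeStep_of_zsmul_eq_zero hp2 h2 hI hz hgen hinf (t := -(n • z) + t)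
      (J.add_mem (J.neg_mem (h2.1 hnz)) htJ) (fun h => htI ?_) ?_
    · have := I.add_mem hnz h
      rwa [add_neg_cancel_left] at this
    · rw [(hzt.zsmul_left n).neg_left.zsmul_add, hm, zsmul_neg, ← mul_zsmul, neg_add_cancel]
  · left
    obtain ⟨v, u, huv⟩ := ((Nat.prime_iff_prime_int.mp h2.2.1).coprime_iff_not_dvd).mpr hdvd
    refine socleStep_of_zsmul_eq hp2 h2 hI hz hgen hinf (h := v • z + u • t)
      (J.add_mem (J.zsmul_mem (h2.1 hz) v) (J.zsmul_mem htJ u)) ?_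
    rw [(hzt.zsmul_zsmul v u).zsmul_add, ← mul_zsmul, ← mul_zsmul, mul_comm _ u, mul_zsmul t u, hm,
      ← mul_zsmul, ← add_zsmul, mul_comm (p : ℤ), huv, one_zsmul]

theorem socleStep_or_exists_primeStep {p : ℕ} (hp2 : Odd p) {E I J : Ideal B}
    (h1 : SocleStep E I) (h2 : PrimeStep p I J) :
    SocleStep E J ∨ ∃ K, PrimeStep p E K ∧ SocleStep K J := by
  obtain ⟨I, rfl⟩ := exists_comap_eq h1.1
  obtain ⟨J, rfl⟩ := exists_comap_eq (le_trans h1.1 h2.1)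
  refine (socleStep_or_exists_primeStep_bot hp2 (socleStep_comap_iff_bot.mp h1)
    (primeStep_comap_iff.mp h2)).imp socleStep_comap_iff_bot.mpr ?_
  rintro ⟨K, hK1, hK2⟩
  exact ⟨comap E K, primeStep_comap_iff_bot.mpr hK1, socleStep_comap_iff.mpr hK2⟩

end Ideal

end SkewBrace

open Relation (ReflTransGen)

theorem Relation.ReflTransGen.exists_nat_chain {α : Type*} {r : α → α → Prop} {a b : α}
    (h : ReflTransGen r a b) :
    ∃ (n : ℕ) (f : ℕ → α), f 0 = a ∧ f n = b ∧ ∀ i < n, r (f i) (f (i + 1)) := by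
  induction h with
  | refl => exact ⟨0, fun _ => a, rfl, rfl, by simp⟩
  | @tail b c _ hbc ih =>
    obtain ⟨n, f, h0, hn, hf⟩ := ih
    refine ⟨n + 1, fun i => if i ≤ n then f i else c, by simpa using h0, by simp, fun i hi => ?_⟩
    rcases Nat.lt_succ_iff_lt_or_eq.mp hi with h | rfl
    · simpa [h.le, Nat.succ_le_of_lt h] using hf i h
    · simpa [hn] using hbc

namespace SkewBrace

namespace Ideal

variable {B : Type*} [SkewBrace B]

/-- There is a chain of ideals from `⊥` to `I` whose factors have odd prime orders, weakly
decreasing and all at least `q`. -/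
inductive DescendingOddChain : ℕ → Ideal B → Prop
  | bot (q : ℕ) : DescendingOddChain q ⊥
  | step {p q : ℕ} {I J : Ideal B} : DescendingOddChain p I → PrimeStep p I J → Odd p → q ≤ p →
      DescendingOddChain q J

theorem DescendingOddChain.insert {p q : ℕ} {I J : Ideal B} (hI : DescendingOddChain q I)
    (hp : Odd p) (h : PrimeStep p I J) : DescendingOddChain (min p q) J := by
  induction hI generalizing J with
  | bot q => exact .step (.bot p) h hp (min_le_left _ _)
  | @step p' q I' I hI' hstep hp' hq ih =>
    rcases le_or_gt p p' with hle | hlt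
    · exact .step (.step hI' hstep hp' hle) h hp (min_le_left _ _)
    · obtain ⟨K, hK1, hK2⟩ := exists_primeStep_of_lt hlt hstep h
      have hK := ih hK1
      rw [min_eq_right hlt.le] at hK
      exact .step hK hK2 hp' ((min_le_right _ _).trans hq)

theorem DescendingOddChain.exists_nat_chain {q : ℕ} {J : Ideal B} (h : DescendingOddChain q J) :
    ∃ (l : ℕ) (f : ℕ → Ideal B) (P : ℕ → ℕ), f 0 = ⊥ ∧ f l = J ∧
      (∀ i < l, PrimeStep (P i) (f i) (f (i + 1)) ∧ Odd (P i) ∧ q ≤ P i) ∧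
      ∀ i, i + 1 < l → P (i + 1) ≤ P i := by
  induction h with
  | bot q => exact ⟨0, fun _ => ⊥, fun _ => 0, rfl, rfl, by simp, by simp⟩
  | @step p q I J _ hIJ hp hq ih =>
    obtain ⟨l, f, P, h0, hl, hf, hP⟩ := ih
    refine ⟨l + 1, fun i => if i ≤ l then f i else J, fun i => if i < l then P i else p,
      by simpa using h0, by simp, fun i hi => ?_, fun i hi => ?_⟩
    · rcases Nat.lt_succ_iff_lt_or_eq.mp hi with h | rfl
      · obtain ⟨h1, h2, h3⟩ := hf i h
        simpa [h, h.le, Nat.succ_le_of_lt h] using ⟨h1, h2, hq.trans h3⟩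
      · simpa [hl] using ⟨hIJ, hp, hq⟩
    · have hil : i < l := by omega
      rcases Nat.lt_or_ge (i + 1) l with h | h
      · simpa [h, hil] using hP i h
      · simpa [hil, h.not_gt] using (hf i hil).2.2

theorem exists_reflTransGen_primeStep_two {p : ℕ} (hp : p ≠ 2) {C J K : Ideal B}
    (h : ReflTransGen (PrimeStep 2) C J) (hJK : PrimeStep p J K) :
    ∃ C', PrimeStep p C C' ∧ ReflTransGen (PrimeStep 2) C' K := by
  induction h generalizing K with
  | refl => exact ⟨K, hJK, .refl⟩
  | tail _ hstep ih =>
    have hlt : 2 < p := lt_of_le_of_ne hJK.2.1.two_le hp.symm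
    obtain ⟨L, hL1, hL2⟩ := exists_primeStep_of_lt hlt hstep hJK
    obtain ⟨C', h1, h2⟩ := ih hL1
    exact ⟨C', h1, h2.tail hL2⟩

theorem exists_socleStep_reflTransGen {C J K : Ideal B} (h : ReflTransGen (PrimeStep 2) C J)
    (hJK : SocleStep J K) : ∃ C', SocleStep C C' ∧ ReflTransGen (PrimeStep 2) C' K := by
  induction h generalizing K with
  | refl => exact ⟨K, hJK, .refl⟩
  | tail _ hstep ih =>
    obtain ⟨L, M, hL, hM, hK⟩ := exists_socleStep_of_primeStep_two hstep hJK
    obtain ⟨C', h1, h2⟩ := ih hL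
    exact ⟨C', h1, (h2.tail hM).tail hK⟩

theorem reflTransGen_socleStep_or {p : ℕ} (hp : Odd p) {A J K : Ideal B}
    (h : ReflTransGen SocleStep A J) (hJK : PrimeStep p J K) :
    ReflTransGen SocleStep A K ∨
      ∃ A', PrimeStep p A A' ∧ ReflTransGen SocleStep A' K := by
  induction h generalizing K with
  | refl => exact Or.inr ⟨K, hJK, .refl⟩
  | tail h hstep ih =>
    rcases socleStep_or_exists_primeStep hp hstep hJK with h' | ⟨L, hL1, hL2⟩
    · exact Or.inl (h.tail h')
    · rcases ih hL1 with h' | ⟨A', h1, h2⟩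
      · exact Or.inl (h'.tail hL2)
      · exact Or.inr ⟨A', h1, h2.tail hL2⟩

/-- There is a chain from `⊥` to `J` of the sorted shape: odd primes in weakly decreasing order,
then infinite cyclic socle factors, then factors of order two. -/
def HasSortedChain (J : Ideal B) : Prop :=
  ∃ A C, DescendingOddChain 0 A ∧ ReflTransGen SocleStep A C ∧ ReflTransGen (PrimeStep 2) C J

theorem HasSortedChain.socleStep {J K : Ideal B} (hJ : HasSortedChain J) (h : SocleStep J K) :
    HasSortedChain K := by
  obtain ⟨A, C, hA, hC, hCJ⟩ := hJ
  obtain ⟨C', h1, h2⟩ := exists_socleStep_reflTransGen hCJ h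
  exact ⟨A, C', hA, hC.tail h1, h2⟩

theorem HasSortedChain.primeStep {p : ℕ} {J K : Ideal B} (hJ : HasSortedChain J)
    (h : PrimeStep p J K) : HasSortedChain K := by
  obtain ⟨A, C, hA, hC, hCJ⟩ := hJ
  rcases eq_or_ne p 2 with rfl | hp
  · exact ⟨A, C, hA, hC, hCJ.tail h⟩
  · have hodd := h.2.1.odd_of_ne_two hp
    obtain ⟨C', h1, h2⟩ := exists_reflTransGen_primeStep_two hp hCJ h
    rcases reflTransGen_socleStep_or hodd hC h1 with h' | ⟨A', h3, h4⟩
    · exact ⟨A, C', hA, h', h2⟩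
    · have hA' := hA.insert hodd h3
      rw [min_eq_right (Nat.zero_le p)] at hA'
      exact ⟨A', C', hA', h4, h2⟩

theorem hasSortedChain_top (hB : IsSupersoluble B) : HasSortedChain (⊤ : Ideal B) := by
  obtain ⟨n, I, h0, hn, hI⟩ := hB
  rw [← hn]
  suffices h : ∀ k ≤ n, HasSortedChain (I k) from h n le_rfl
  intro k hk
  induction k with
  | zero => rw [h0]; exact ⟨⊥, ⊥, .bot 0, .refl, .refl⟩
  | succ k ih =>
    obtain ⟨hle, h | h⟩ := hI k (by omega)
    · exact (ih (by omega)).socleStep (socleStep_iff.mpr ⟨hle, h⟩)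
    · exact (ih (by omega)).primeStep (primeStep_iff.mpr ⟨hle, h, rfl⟩)

end Ideal

end SkewBrace

theorem theorem3p9 {B : Type*} [SkewBrace B] (hB : SkewBrace.IsSupersoluble B) :
    ∃ (l m n : ℕ) (I₀ I₁ I₂ : ℕ → SkewBrace.Ideal B),
      (I₀ 0 = ⊥ ∧ I₀ l = I₁ 0 ∧ I₁ m = I₂ 0 ∧ I₂ n = ⊤) ∧
      ((∀ i < l, I₀ i ≤ I₀ (i + 1)) ∧ (∀ i < m, I₁ i ≤ I₁ (i + 1)) ∧
        (∀ i < n, I₂ i ≤ I₂ (i + 1))) ∧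
      (∀ i < l, (Nat.card (SkewBrace.Ideal.factor (I₀ i) (I₀ (i + 1)))).Prime ∧
        Odd (Nat.card (SkewBrace.Ideal.factor (I₀ i) (I₀ (i + 1))))) ∧
      (∀ i, i + 1 < l →
        Nat.card (SkewBrace.Ideal.factor (I₀ (i + 1)) (I₀ (i + 2))) ≤
          Nat.card (SkewBrace.Ideal.factor (I₀ i) (I₀ (i + 1)))) ∧
      (∀ i < m, SkewBrace.Ideal.IsInfiniteCyclicSocleFactor (I₁ i) (I₁ (i + 1))) ∧
      (∀ i < n, Nat.card (SkewBrace.Ideal.factor (I₂ i) (I₂ (i + 1))) = 2) := by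
  obtain ⟨A, C, hA, hC, hT⟩ := SkewBrace.Ideal.hasSortedChain_top hB
  obtain ⟨l, I₀, P, h00, h0l, h0, hP⟩ := hA.exists_nat_chain
  obtain ⟨m, I₁, h10, h1m, h1⟩ := hC.exists_nat_chain
  obtain ⟨n, I₂, h20, h2n, h2⟩ := hT.exists_nat_chain
  have hcard : ∀ i < l, Nat.card (SkewBrace.Ideal.factor (I₀ i) (I₀ (i + 1))) = P i :=
    fun i hi => (SkewBrace.Ideal.primeStep_iff.mp (h0 i hi).1).2.2
  refine ⟨l, m, n, I₀, I₁, I₂, ⟨h00, h0l.trans h10.symm, h1m.trans h20.symm, h2n⟩,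
    ⟨fun i hi => (h0 i hi).1.1, fun i hi => (h1 i hi).1, fun i hi => (h2 i hi).1⟩,
    fun i hi => ?_, fun i hi => ?_,
    fun i hi => (SkewBrace.Ideal.socleStep_iff.mp (h1 i hi)).2,
    fun i hi => (SkewBrace.Ideal.primeStep_iff.mp (h2 i hi)).2.2⟩
  · rw [hcard i hi]
    exact ⟨(h0 i hi).1.2.1, (h0 i hi).2.1⟩
  · rw [hcard i (by omega), hcard (i + 1) hi]
    exact hP i hi
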